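/- Let $\Phi$ be a point process on $\mathbb{R}^d$, that is, a random measure taking finite non-negative integer values on bounded Borel sets, and let $\Phi_\lambda$ be a homogeneous Poisson point process of intensity $\lambda>0$. A function $f:\mathbb{R}^n\to\mathbb{R}$ is directionally convex ($dcx$) if $f(x)+f(y)\le f(p)+f(q)$ whenever $p\le x,y\le q$ componentwise and $x+y=p+q$; it is $idcx$ (resp. $ddcx$) if it is moreover increasing (resp. decreasing). Write $\Phi\le_{dcx}\Phi_\lambda$ (resp. $\le_{idcx}$, $\le_{ddcx}$) if for all bounded Borel sets $B_1,\dots,B_n$ one has $\mathbb{E} f(\Phi(B_1),\dots,\Phi(B_n))\le \mathbb{E} f(\Phi_\lambda(B_1),\dots,\Phi_\lambda(B_n))$ for every $dcx$ (resp. $idcx$, $ddcx$) function $f$ for which both expectations are finite. Let $C(\Phi,r)$ be the union of the balls of radius $r$ centred at the points of $\Phi$; it percolates if it has an unbounded connected subset. Let $$r_c(\Phi)=\inf\{r>0:\ \mathbb{P}(C(\Phi,r)\text{ percolates})>0\}\in[0,\infty],\qquad \inf\emptyset=\infty .$$ There are constants $0<c(\lambda)\le C(\lambda)<\infty$, depending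 only on $\lambda>0$ and the dimension $d\ge1$, such that the following hold. 1. If $\Phi$ has a locally finite mean measure ($\mathbb{E}\,\Phi(B)<\infty$ for bounded Borel $B$) and $\Phi\le_{idcx}\Phi_\lambda$, then $r_c(\Phi)\ge c(\lambda)$. 2. If $d\ge2$ and $\Phi\le_{ddcx}\Phi_\lambda$, then $r_c(\Phi)\le C(\lambda)$. 3. If $\Phi$ is homogeneous of intensity $\lambda$ (i.e. $\mathbb{E}\,\Phi(B)=\lambda|B|$ for bounded Borel $B$) and $\Phi\le_{dcx}\Phi_\lambda$, then $r_c(\Phi)\ge c(\lambda)$, and for $d\ge2$ also $r_c(\Phi)\le C(\lambda)$; thus for $d\ge 2$ one has $0<c(\lambda)\le r_c(\Phi)\le C(\lambda)<\infty$. 4. If $\Phi$ is weakly sub-Poisson with constant $\lambda$, i.e. for every $k\ge1$ there is a joint intensity $\rho^{(k)}$ with $\mathbb{E}\prod_{i=1}^k\Phi(B_i)=\int_{B_1\times\dots\times B_k}\rho^{(k)}(x)\,dx$ for all pairwise disjoint bounded Borel sets $B_1,\dots,B_k$, and $\rho^{(k)}\le\lambda^k$ almost everywhere, then $r_c(\Phi)\ge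 c(\lambda)$. -/

import Mathlib

open MeasureTheory ProbabilityTheory
open scoped ENNReal NNReal

universe u v

namespace SubPoisson

/-- The space in which the points live, with its Euclidean norm, its Borel sets and Lebesgue
measure. -/
abbrev Space (d : ℕ) : Type := EuclideanSpace ℝ (Fin d)

/-- Bounded Borel sets. -/
def IsBddBorel {d : ℕ} (B : Set (Space d)) : Prop :=
  MeasurableSet B ∧ Bornology.IsBounded B

section Orders

variable {n : ℕ}

/-- Directionally convex functions; `≤` on `Fin n → ℝ` is the componentwise order. -/
def IsDcx (f : (Fin n → ℝ) → ℝ) : Prop :=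
  ∀ x y p q : Fin n → ℝ, p ≤ x → p ≤ y → x ≤ q → y ≤ q → x + y = p + q →
    f x + f y ≤ f p + f q

/-- Increasing directionally convex functions. -/
def IsIdcx (f : (Fin n → ℝ) → ℝ) : Prop := Monotone f ∧ IsDcx f

/-- Decreasing directionally convex functions. -/
def IsDdcx (f : (Fin n → ℝ) → ℝ) : Prop := Antitone f ∧ IsDcx f

end Orders

/-- The integral stochastic order of random vectors generated by a class `F` of test functions:
`E f(X) ≤ E f(Y)` for all `f` in the class for which both expectations are finite. -/
def VecLE {n : ℕ} (F : ((Fin n → ℝ) → ℝ) → Prop)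
    {Ω : Type u} [MeasurableSpace Ω] (P : Measure Ω) (X : Ω → Fin n → ℝ)
    {Ω' : Type v} [MeasurableSpace Ω'] (Q : Measure Ω') (Y : Ω' → Fin n → ℝ) : Prop :=
  ∀ f : (Fin n → ℝ) → ℝ, F f →
    Integrable (fun ω => f (X ω)) P → Integrable (fun ω => f (Y ω)) Q →
    ∫ ω, f (X ω) ∂P ≤ ∫ ω, f (Y ω) ∂Q

/-- A point process: a random measure taking a (finite) natural number as value on every bounded
Borel set.  Multiple points are allowed. -/
structure IsPointProcess {d : ℕ} {Ω : Type u} [MeasurableSpace Ω]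
    (Φ : Ω → Measure (Space d)) : Prop where
  measurable : Measurable Φ
  natValued : ∀ ω (B : Set (Space d)), IsBddBorel B → ∃ n : ℕ, Φ ω B = n

section Comparison

variable {d : ℕ} {Ω : Type u} [MeasurableSpace Ω] {Ω' : Type v} [MeasurableSpace Ω']

/-- The vector `(Φ(B₁), …, Φ(Bₙ))` of numbers of points. -/
noncomputable def counts (Φ : Ω → Measure (Space d)) {n : ℕ} (B : Fin n → Set (Space d)) (ω : Ω) :
    Fin n → ℝ :=
  fun i => (Φ ω).real (B i)

/-- `Φ ≤_dcx Ψ`. -/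
def DcxLE (P : Measure Ω) (Φ : Ω → Measure (Space d))
    (Q : Measure Ω') (Ψ : Ω' → Measure (Space d)) : Prop :=
  ∀ (n : ℕ) (B : Fin n → Set (Space d)), (∀ i, IsBddBorel (B i)) →
    VecLE IsDcx P (counts Φ B) Q (counts Ψ B)

/-- `Φ ≤_idcx Ψ`. -/
def IdcxLE (P : Measure Ω) (Φ : Ω → Measure (Space d))
    (Q : Measure Ω') (Ψ : Ω' → Measure (Space d)) : Prop :=
  ∀ (n : ℕ) (B : Fin n → Set (Space d)), (∀ i, IsBddBorel (B i)) →
    VecLE IsIdcx P (counts Φ B) Q (counts Ψ B)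

/-- `Φ ≤_ddcx Ψ`. -/
def DdcxLE (P : Measure Ω) (Φ : Ω → Measure (Space d))
    (Q : Measure Ω') (Ψ : Ω' → Measure (Space d)) : Prop :=
  ∀ (n : ℕ) (B : Fin n → Set (Space d)), (∀ i, IsBddBorel (B i)) →
    VecLE IsDdcx P (counts Φ B) Q (counts Ψ B)

/-- `Φ` has a locally finite mean measure: `E Φ(B) < ∞` for all bounded Borel sets `B`. -/
def HasLocallyFiniteMean (P : Measure Ω) (Φ : Ω → Measure (Space d)) : Prop :=
  ∀ B : Set (Space d), IsBddBorel B → ∫⁻ ω, Φ ω B ∂P < ∞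

/-- `Φ` is homogeneous with intensity `lam`: `E Φ(B) = lam |B|` for all bounded Borel sets `B`. -/
def IsHomogeneous (P : Measure Ω) (lam : ℝ) (Φ : Ω → Measure (Space d)) : Prop :=
  ∀ B : Set (Space d), IsBddBorel B → ∫⁻ ω, Φ ω B ∂P = ENNReal.ofReal lam * volume B

/-- `Φ` is a homogeneous Poisson point process of intensity `lam`: the numbers of points in
bounded Borel sets are Poisson with mean `lam |B|`, and independent for disjoint sets. -/
structure IsPoissonProcess (P : Measure Ω) (lam : ℝ) (Φ : Ω → Measure (Space d)) : Prop where
  isPointProcess : IsPointProcess Φ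
  law : ∀ B : Set (Space d), IsBddBorel B →
    P.map (fun ω => Φ ω B) =
      (poissonMeasure (lam * volume.real B).toNNReal).map (fun n : ℕ => (n : ℝ≥0∞))
  indep : ∀ (n : ℕ) (B : Fin n → Set (Space d)), (∀ i, IsBddBorel (B i)) →
    Pairwise (fun i j => Disjoint (B i) (B j)) → iIndepFun (fun i ω => Φ ω (B i)) P

/-- `ρ` is a joint intensity of order `k` of `Φ`. -/
def IsJointIntensity (P : Measure Ω) (Φ : Ω → Measure (Space d)) (k : ℕ)
    (ρ : (Fin k → Space d) → ℝ≥0∞) : Prop :=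
  Measurable ρ ∧
    ∀ B : Fin k → Set (Space d), (∀ i, IsBddBorel (B i)) →
      Pairwise (fun i j => Disjoint (B i) (B j)) →
      ∫⁻ ω, ∏ i, Φ ω (B i) ∂P = ∫⁻ x in Set.univ.pi B, ρ x

/-- `Φ` is weakly sub-Poisson with constant `lam`: the joint intensities of all orders `k ≥ 1`
exist and are almost everywhere at most `lam ^ k`. -/
def IsWeaklySubPoisson (P : Measure Ω) (lam : ℝ) (Φ : Ω → Measure (Space d)) : Prop :=
  ∀ k : ℕ, 1 ≤ k → ∃ ρ : (Fin k → Space d) → ℝ≥0∞,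
    IsJointIntensity P Φ k ρ ∧ ∀ᵐ x, ρ x ≤ ENNReal.ofReal lam ^ k

end Comparison

/-- The points of a counting measure: its atoms. -/
def points {d : ℕ} (φ : Measure (Space d)) : Set (Space d) := {x | φ {x} ≠ 0}

/-- The Boolean model `C(φ, r)`. -/
def booleanModel {d : ℕ} (φ : Measure (Space d)) (r : ℝ) : Set (Space d) :=
  ⋃ x ∈ points φ, Metric.closedBall x r

/-- A set percolates if it has an unbounded connected subset. -/
def Percolates {d : ℕ} (C : Set (Space d)) : Prop :=
  ∃ S ⊆ C, IsConnected S ∧ ¬ Bornology.IsBounded S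

/-- The critical radius, with values in `[0, ∞]`; it is `∞` when there is no `r > 0` for which the
Boolean model percolates with positive probability. -/
noncomputable def criticalRadius {d : ℕ} {Ω : Type u} [MeasurableSpace Ω] (P : Measure Ω)
    (Φ : Ω → Measure (Space d)) : ℝ≥0∞ :=
  sInf (ENNReal.ofReal '' {r : ℝ | 0 < r ∧ 0 < P {ω | Percolates (booleanModel (Φ ω) r)}})

end SubPoisson

/-! Space is cut into cubic cells, and everything follows from two estimates for a finite set `A` of
cells: for small cells, P(all cells of `A` charged) ≤ (2·3^d)^(-|A|); for large cells, P(all cells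
of `A` empty) ≤ 243^(-|A|). Both concern one count, the number of points in the union of `A`: if all
cells are charged it is at least |A|, and all cells are empty exactly when it is 0. So the orders
are only tested on convex functions of one variable, (x+1-n)₊ and (1-x)₊, and the Poisson generating
function bounds the result (`IdcxLE.measure_count_ge_le`, `DdcxLE.measure_count_eq_zero_le`). In the
weakly sub-Poisson case the product of the counts, computed from the joint intensity, replaces the
tail bound.

Lower bound on the critical radius: if balls smaller than half a cell percolate, arbitrarily long
self-avoiding paths of charged cells start from some cell. There are at most 3^(dn) paths of n
steps, so the first estimate makes this a null event (`measure_percolates_eq_zero`).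

Upper bound: the argument lives in a quadrant of a coordinate plane and avoids planar duality. A box
of side 3^(k+1) is good if at most one of its nine subboxes is bad. A bad box of level k contains
one of at most 81^(2^k) sets of 2^k empty cells, so with positive probability all boxes at the
origin are good. A 3×3 grid minus one site is connected, and neighbouring good boxes share a pair of
good subboxes across their common face; hence the origin is joined to charged cells arbitrarily far
away (`exists_far_of_isGood`). -/

namespace SubPoisson

/-! ### Counting measures and lattice cells -/

section Configurations

variable {d : ℕ}

/-- A measure with natural values on bounded Borel sets charges a bounded Borel set only through
its atoms. -/
lemma exists_mem_points {φ : Measure (Space d)}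
    (hφ : ∀ B : Set (Space d), IsBddBorel B → ∃ n : ℕ, φ B = n)
    {B : Set (Space d)} (hB : φ B ≠ 0) : ∃ x ∈ B, x ∈ points φ := by
  by_contra! hno
  -- Around a non-atom, small balls have measure below 1, hence 0 by integrality; local nullness
  -- then gives nullness.
  refine hB (measure_null_of_locally_null B fun x hx => ?_)
  have hx0 : φ {x} = 0 := by
    by_contra h
    exact hno x hx h
  have hanti : Antitone fun n : ℕ => Metric.closedBall x (1 / ((n : ℝ) + 1)) := fun m n hmn =>
    Metric.closedBall_subset_closedBall (Nat.one_div_le_one_div hmn)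
  have hbdd : ∀ n : ℕ, IsBddBorel (Metric.closedBall x (1 / ((n : ℝ) + 1))) := fun n =>
    ⟨Metric.isClosed_closedBall.measurableSet, Metric.isBounded_closedBall⟩
  have hfin : φ (Metric.closedBall x (1 / (((0 : ℕ) : ℝ) + 1))) ≠ ∞ := by
    obtain ⟨n, hn⟩ := hφ _ (hbdd 0)
    rw [hn]
    exact ENNReal.natCast_ne_top n
  have hlim := tendsto_measure_iInter_atTop (μ := φ)
    (fun n => (hbdd n).1.nullMeasurableSet) hanti ⟨0, hfin⟩
  have hinter : (⋂ n : ℕ, Metric.closedBall x (1 / ((n : ℝ) + 1))) = {x} := by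
    ext y
    simp only [Set.mem_iInter, Metric.mem_closedBall, Set.mem_singleton_iff]
    refine ⟨fun h => ?_, fun h n => ?_⟩
    · refine dist_le_zero.1 (ge_of_tendsto' tendsto_one_div_add_atTop_nhds_zero_nat h)
    · rw [h, dist_self]
      positivity
  rw [hinter, hx0] at hlim
  obtain ⟨n, hn⟩ := (hlim.eventually (gt_mem_nhds zero_lt_one)).exists
  refine ⟨_, mem_nhdsWithin_of_mem_nhds (Metric.closedBall_mem_nhds x (by positivity :
    (0 : ℝ) < 1 / ((n : ℝ) + 1))), ?_⟩
  obtain ⟨m, hm⟩ := hφ _ (hbdd n)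
  simp only [Function.comp] at hn
  rw [hm] at hn ⊢
  have : m < 1 := by exact_mod_cast hn
  simp [Nat.lt_one_iff.1 this]

lemma measure_ne_zero_of_mem_points {φ : Measure (Space d)} {B : Set (Space d)} {x : Space d}
    (hx : x ∈ points φ) (hB : x ∈ B) : φ B ≠ 0 := fun h =>
  hx (measure_mono_null (Set.singleton_subset_iff.2 hB) h)

lemma norm_le_of_forall_abs_le {y : Space d} {M : ℝ} (hM : 0 ≤ M) (h : ∀ k, |y k| ≤ M) :
    ‖y‖ ≤ d * M := by
  refine abs_le_of_sq_le_sq' ?_ (by positivity) |>.2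
  rw [EuclideanSpace.norm_sq_eq]
  calc ∑ k, ‖y k‖ ^ 2 ≤ ∑ _k : Fin d, M ^ 2 := by
        gcongr with k
        exact h k
    _ = d * M ^ 2 := by simp
    _ ≤ (d * M) ^ 2 := by
        rw [mul_pow]
        gcongr
        exact_mod_cast Nat.le_self_pow two_ne_zero d

/-- The cells of the lattice of side `s`. -/
def cell (s : ℝ) (z : Fin d → ℤ) : Set (Space d) := {x | ∀ k, ⌊x k / s⌋ = z k}

lemma pairwise_disjoint_cell (s : ℝ) {z w : Fin d → ℤ} (h : z ≠ w) :
    Disjoint (cell s z) (cell s w) :=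
  Set.disjoint_left.2 fun _ hx hy => h (funext fun k => (hx k).symm.trans (hy k))

lemma mem_cell_floor (s : ℝ) (x : Space d) : x ∈ cell s (fun k => ⌊x k / s⌋) := fun _ => rfl

lemma mem_cell_iff {s : ℝ} (hs : 0 < s) {z : Fin d → ℤ} {x : Space d} :
    x ∈ cell s z ↔ ∀ k, s * z k ≤ x k ∧ x k < s * (z k + 1) := by
  simp only [cell, Set.mem_ofPred_eq, Int.floor_eq_iff, le_div_iff₀ hs, div_lt_iff₀ hs, mul_comm s]

lemma cell_eq_preimage {s : ℝ} (hs : 0 < s) (z : Fin d → ℤ) :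
    cell s z = WithLp.ofLp ⁻¹' Set.univ.pi fun k => Set.Ico (s * z k) (s * (z k + 1)) := by
  ext x
  simp [mem_cell_iff hs]

lemma measurableSet_cell {s : ℝ} (hs : 0 < s) (z : Fin d → ℤ) : MeasurableSet (cell s z) := by
  rw [cell_eq_preimage hs]
  exact (PiLp.volume_preserving_ofLp (Fin d)).measurable
    (MeasurableSet.univ_pi fun _ => measurableSet_Ico)

lemma volume_cell {s : ℝ} (hs : 0 < s) (z : Fin d → ℤ) :
    volume (cell s z) = ENNReal.ofReal (s ^ d) := by
  rw [cell_eq_preimage hs, (PiLp.volume_preserving_ofLp (Fin d)).measure_preimage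
    (MeasurableSet.univ_pi fun _ => measurableSet_Ico).nullMeasurableSet, Real.volume_pi_Ico]
  simp [mul_add, ENNReal.ofReal_pow hs.le]

lemma isBddBorel_cell {s : ℝ} (hs : 0 < s) (z : Fin d → ℤ) : IsBddBorel (cell s z) := by
  refine ⟨measurableSet_cell hs z, (Metric.isBounded_iff_subset_closedBall 0).2
    ⟨d * (s * ((∑ k, |(z k : ℝ)|) + 1)), fun x hx => ?_⟩⟩
  rw [mem_closedBall_zero_iff]
  refine norm_le_of_forall_abs_le (by positivity) fun k => ?_
  obtain ⟨h1, h2⟩ := (mem_cell_iff hs).1 hx k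
  have h3 : |(z k : ℝ)| ≤ ∑ k, |(z k : ℝ)| :=
    Finset.single_le_sum (f := fun k => |(z k : ℝ)|) (fun _ _ => abs_nonneg _) (Finset.mem_univ k)
  have h4 := mul_le_mul_of_nonneg_left (h3.trans' (le_abs_self _)) hs.le
  have h5 := mul_le_mul_of_nonneg_left (h3.trans' (neg_le_abs _)) hs.le
  rw [abs_le]
  constructor <;> nlinarith

lemma isBddBorel_biUnion_cell {s : ℝ} (hs : 0 < s) (A : Finset (Fin d → ℤ)) :
    IsBddBorel (⋃ z ∈ A, cell s z) :=
  ⟨A.measurableSet_biUnion fun z _ => measurableSet_cell hs z,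
    (Bornology.isBounded_biUnion_finset A).2 fun z _ => (isBddBorel_cell hs z).2⟩

lemma measure_biUnion_cell (φ : Measure (Space d)) {s : ℝ} (hs : 0 < s)
    (A : Finset (Fin d → ℤ)) : φ (⋃ z ∈ A, cell s z) = ∑ z ∈ A, φ (cell s z) :=
  measure_biUnion_finset (fun _ _ _ _ h => pairwise_disjoint_cell s h)
    fun z _ => measurableSet_cell hs z

lemma volume_real_biUnion_cell {s : ℝ} (hs : 0 < s) (A : Finset (Fin d → ℤ)) :
    volume.real (⋃ z ∈ A, cell s z) = A.card * s ^ d := by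
  rw [measureReal_def, measure_biUnion_cell _ hs]
  simp [volume_cell hs, ENNReal.toReal_ofReal (pow_nonneg hs.le d)]

end Configurations

/-! ### Tails and void probabilities of a single count -/

section SingleCounts

variable {d : ℕ} {Ω : Type u} [MeasurableSpace Ω] {Ω' : Type v} [MeasurableSpace Ω']

lemma lintegral_poissonMeasure (r : ℝ≥0) (g : ℕ → ℝ≥0∞) :
    ∫⁻ n, g n ∂poissonMeasure r =
      ∑' n : ℕ, ENNReal.ofReal (Real.exp (-r) * r ^ n / n.factorial) * g n := by
  simp [poissonMeasure, lintegral_sum_measure, lintegral_smul_measure]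

/-- The generating function serves twice: with `a ≥ 2` for upper tails, and with `a = 0`, where `0 ^
0 = 1` picks out the void probability. -/
lemma lintegral_pow_poissonMeasure (r : ℝ≥0) {a : ℝ} (ha : 0 ≤ a) :
    ∫⁻ n, ENNReal.ofReal (a ^ n) ∂poissonMeasure r = ENNReal.ofReal (Real.exp (r * (a - 1))) := by
  have hs : HasSum (fun n : ℕ => Real.exp (-r) * ((r * a) ^ n / n.factorial))
      (Real.exp (-r) * Real.exp (r * a)) := by
    rw [Real.exp_eq_exp_ℝ]
    exact (NormedSpace.expSeries_div_hasSum_exp ((r : ℝ) * a)).mul_left _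
  have he : Real.exp (r * (a - 1)) = Real.exp (-r) * Real.exp (r * a) := by
    rw [← Real.exp_add]
    ring_nf
  rw [lintegral_poissonMeasure, he, ← hs.tsum_eq,
    ENNReal.ofReal_tsum_of_nonneg (fun n => by positivity) hs.summable]
  refine tsum_congr fun n => ?_
  rw [← ENNReal.ofReal_mul (by positivity), mul_pow]
  ring_nf

lemma measurable_count {Φ : Ω → Measure (Space d)} (hΦ : IsPointProcess Φ) {B : Set (Space d)}
    (hB : MeasurableSet B) : Measurable fun ω => (Φ ω).real B :=
  ((Measure.measurable_coe hB).comp hΦ.measurable).ennreal_toReal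

lemma IsPointProcess.exists_real_eq {Φ : Ω → Measure (Space d)} (hΦ : IsPointProcess Φ)
    {B : Set (Space d)} (hB : IsBddBorel B) (ω : Ω) :
    ∃ n : ℕ, Φ ω B = n ∧ (Φ ω).real B = n := by
  obtain ⟨n, hn⟩ := hΦ.natValued ω B hB
  exact ⟨n, hn, by simp [measureReal_def, hn]⟩

lemma IsPoissonProcess.lintegral_count {Q : Measure Ω} {lam : ℝ} {Φ : Ω → Measure (Space d)}
    (hΦ : IsPoissonProcess Q lam Φ) {B : Set (Space d)} (hB : IsBddBorel B) {g : ℝ → ℝ}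
    (hg : Measurable g) :
    ∫⁻ ω, ENNReal.ofReal (g ((Φ ω).real B)) ∂Q =
      ∫⁻ n : ℕ, ENNReal.ofReal (g n) ∂poissonMeasure (lam * volume.real B).toNNReal := by
  have hm : Measurable fun x : ℝ≥0∞ => ENNReal.ofReal (g x.toReal) :=
    (hg.comp ENNReal.measurable_toReal).ennreal_ofReal
  have h1 := lintegral_map (μ := Q) hm
    ((Measure.measurable_coe hB.1).comp hΦ.isPointProcess.measurable)
  simp only [Function.comp_def] at h1
  rw [hΦ.law B hB, lintegral_map hm .of_discrete] at h1
  simpa [measureReal_def] using h1.symm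

/-- Transfer of a bound from a Poisson process to a process below it, for a nonnegative test
function of a single count. -/
lemma lintegral_count_le {F : ((Fin 1 → ℝ) → ℝ) → Prop} {P : Measure Ω}
    {Φ : Ω → Measure (Space d)} {Q : Measure Ω'} {Ψ : Ω' → Measure (Space d)} {lam : ℝ}
    (hΨ : IsPoissonProcess Q lam Ψ) {B : Set (Space d)} (hB : IsBddBorel B)
    (hF : VecLE F P (counts Φ fun _ => B) Q (counts Ψ fun _ => B))
    {g : ℝ → ℝ} (hg : Measurable g) (hg0 : ∀ x, 0 ≤ g x) (hgF : F fun x => g (x 0))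
    (hint : Integrable (fun ω => g ((Φ ω).real B)) P)
    (hfin : ∫⁻ n : ℕ, ENNReal.ofReal (g n) ∂poissonMeasure (lam * volume.real B).toNNReal ≠ ∞) :
    ∫⁻ ω, ENNReal.ofReal (g ((Φ ω).real B)) ∂P ≤
      ∫⁻ n : ℕ, ENNReal.ofReal (g n) ∂poissonMeasure (lam * volume.real B).toNNReal := by
  rw [← hΨ.lintegral_count hB hg] at hfin ⊢
  have hint' : Integrable (fun ω => g ((Ψ ω).real B)) Q :=
    (lintegral_ofReal_ne_top_iff_integrable
      (hg.comp (measurable_count hΨ.isPointProcess hB.1)).aestronglyMeasurable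
      (ae_of_all _ fun _ => hg0 _)).1 hfin
  rw [← ofReal_integral_eq_lintegral_ofReal hint (ae_of_all _ fun _ => hg0 _),
    ← ofReal_integral_eq_lintegral_ofReal hint' (ae_of_all _ fun _ => hg0 _)]
  exact ENNReal.ofReal_le_ofReal (hF _ hgF hint hint')

/-- On the line, x and y are convex combinations of p and q with swapped weights, so the two
convexity inequalities add up. -/
lemma isDcx_of_convexOn {g : ℝ → ℝ} (hg : ConvexOn ℝ Set.univ g) :
    IsDcx fun x : Fin 1 → ℝ => g (x 0) := by
  intro x y p q hpx hpy hxq hyq hxy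
  have h1 := hpx 0
  have h2 := hpy 0
  have h3 := hxq 0
  have h4 := hyq 0
  have h5 : x 0 + y 0 = p 0 + q 0 := congrFun hxy 0
  rcases (h1.trans h3).eq_or_lt with h | h
  · have hx : x 0 = p 0 := by linarith
    have hy : y 0 = q 0 := by linarith
    simp [hx, hy]
  · have hd : 0 < q 0 - p 0 := sub_pos.2 h
    set t := (x 0 - p 0) / (q 0 - p 0) with ht
    have ht0 : 0 ≤ t := div_nonneg (by linarith) hd.le
    have ht1 : 0 ≤ 1 - t := sub_nonneg.2 ((div_le_one hd).2 (by linarith))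
    have hx : x 0 = (1 - t) * p 0 + t * q 0 := by
      rw [ht]
      field_simp
      ring
    have hy : y 0 = t * p 0 + (1 - t) * q 0 := by linarith
    have e1 := hg.2 (Set.mem_univ (p 0)) (Set.mem_univ (q 0)) ht1 ht0 (by ring)
    have e2 := hg.2 (Set.mem_univ (p 0)) (Set.mem_univ (q 0)) ht0 ht1 (by ring)
    simp only [smul_eq_mul] at e1 e2
    rw [← hx] at e1
    rw [← hy] at e2
    dsimp only
    linarith

/-- Exponential upper tails of the counts of a process that is `idcx`-below a Poisson process. -/
lemma IdcxLE.measure_count_ge_le {P : Measure Ω} [IsFiniteMeasure P] {Φ : Ω → Measure (Space d)}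
    {Q : Measure Ω'} {Ψ : Ω' → Measure (Space d)} {lam : ℝ} (hlam : 0 ≤ lam)
    (hΦ : IsPointProcess Φ) (hmean : HasLocallyFiniteMean P Φ) (hΨ : IsPoissonProcess Q lam Ψ)
    (hle : IdcxLE P Φ Q Ψ) {B : Set (Space d)} (hB : IsBddBorel B) (n : ℕ) {a : ℝ} (ha : 2 ≤ a) :
    P {ω | (n : ℝ≥0∞) ≤ Φ ω B} ≤
      ENNReal.ofReal (Real.exp (lam * volume.real B * (a - 1)) / a ^ n) := by
  -- At least 1 once the count reaches `n`, and of linear growth: only a finite mean of Φ is needed,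
  -- whereas testing with `a ^ x` directly would need exponential moments of Φ.
  set g : ℝ → ℝ := fun x => max (x + (1 - n)) 0 with hg
  have hgc : Continuous g := by fun_prop
  have hconv : ConvexOn ℝ Set.univ g :=
    ((convexOn_id convex_univ).add_const _).sup (convexOn_const 0 convex_univ)
  have hmono : Monotone g := fun x y hxy => max_le_max (by linarith) le_rfl
  have hint : Integrable (fun ω => g ((Φ ω).real B)) P := by
    have h1 : Integrable (fun ω => (Φ ω).real B) P := integrable_toReal_of_lintegral_ne_top
      ((Measure.measurable_coe hB.1).comp hΦ.measurable).aemeasurable (hmean B hB).ne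
    exact (h1.add (integrable_const _)).sup (integrable_const 0)
  have hpois : ∫⁻ k : ℕ, ENNReal.ofReal (g k)
      ∂poissonMeasure (lam * volume.real B).toNNReal ≤
      ENNReal.ofReal (Real.exp (lam * volume.real B * (a - 1)) / a ^ n) := by
    calc _ ≤ ∫⁻ k : ℕ, ENNReal.ofReal (a ^ k) * ENNReal.ofReal (1 / a ^ n)
          ∂poissonMeasure (lam * volume.real B).toNNReal := by
          refine lintegral_mono fun k => ?_
          rw [← ENNReal.ofReal_mul (by positivity)]
          refine ENNReal.ofReal_le_ofReal ?_
          rw [mul_one_div]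
          refine max_le ?_ (by positivity)
          rcases lt_or_ge k n with hkn | hkn
          · have : (k : ℝ) + 1 ≤ n := by exact_mod_cast hkn
            exact le_trans (by linarith) (show (0 : ℝ) ≤ a ^ k / a ^ n by positivity)
          · obtain ⟨m, rfl⟩ := Nat.exists_eq_add_of_le hkn
            rw [pow_add, mul_div_cancel_left₀ _ (by positivity)]
            -- The use of `2 ≤ a`: m + 1 ≤ 2^m ≤ a^m gives (k+1-n)₊ ≤ a^(k-n).
            have h1 : ((m + 1 : ℕ) : ℝ) ≤ ((2 ^ m : ℕ) : ℝ) := by exact_mod_cast Nat.lt_two_pow_self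
            have h2 : (2 : ℝ) ^ m ≤ a ^ m := by gcongr
            push_cast at h1 ⊢
            linarith
      _ = _ := by
          rw [lintegral_mul_const _ .of_discrete, lintegral_pow_poissonMeasure _ (by positivity),
            ← ENNReal.ofReal_mul (by positivity), Real.coe_toNNReal _ (by positivity), mul_one_div]
  calc P {ω | (n : ℝ≥0∞) ≤ Φ ω B} ≤ ∫⁻ ω, ENNReal.ofReal (g ((Φ ω).real B)) ∂P := by
        refine (measure_mono fun ω hω => ?_).trans ((mul_meas_ge_le_lintegral
          (hgc.measurable.comp (measurable_count hΦ hB.1)).ennreal_ofReal 1).trans_eq' (by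
            rw [one_mul]))
        obtain ⟨m, hm, hm'⟩ := hΦ.exists_real_eq hB ω
        have hω : (n : ℝ≥0∞) ≤ Φ ω B := hω
        rw [hm] at hω
        have h1 : (n : ℝ) ≤ m := by exact_mod_cast hω
        simp only [Set.mem_ofPred_eq, Function.comp, hg, hm', ENNReal.one_le_ofReal]
        exact le_max_of_le_left (by linarith)
    _ ≤ _ := (lintegral_count_le hΨ hB (hle 1 (fun _ => B) fun _ => hB) hgc.measurable
        (fun _ => le_max_right _ _)
        ⟨fun x y h => hmono (h 0), isDcx_of_convexOn hconv⟩ hint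
        (hpois.trans_lt ENNReal.ofReal_lt_top).ne).trans hpois

/-- Void probabilities of a process that is `ddcx`-below a Poisson process. -/
lemma DdcxLE.measure_count_eq_zero_le {P : Measure Ω} [IsFiniteMeasure P]
    {Φ : Ω → Measure (Space d)} {Q : Measure Ω'} {Ψ : Ω' → Measure (Space d)} {lam : ℝ}
    (hlam : 0 ≤ lam) (hΦ : IsPointProcess Φ) (hΨ : IsPoissonProcess Q lam Ψ)
    (hle : DdcxLE P Φ Q Ψ) {B : Set (Space d)} (hB : IsBddBorel B) :
    P {ω | Φ ω B = 0} ≤ ENNReal.ofReal (Real.exp (-(lam * volume.real B))) := by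
  -- On natural numbers this is the indicator of 0; on counts it is bounded, so no moment assumption
  -- on Φ is needed.
  set g : ℝ → ℝ := fun x => max (1 - x) 0 with hg
  have hgc : Continuous g := by fun_prop
  have hconv : ConvexOn ℝ Set.univ g :=
    ((convexOn_const 1 convex_univ).sub (concaveOn_id convex_univ)).sup
      (convexOn_const 0 convex_univ)
  have hanti : Antitone g := fun x y hxy => max_le_max (by linarith) le_rfl
  have hint : Integrable (fun ω => g ((Φ ω).real B)) P := by
    refine Integrable.of_bound
      (hgc.measurable.comp (measurable_count hΦ hB.1)).aestronglyMeasurable 1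
      (ae_of_all _ fun ω => ?_)
    rw [Real.norm_of_nonneg (le_max_right _ _)]
    exact max_le (by linarith [measureReal_nonneg (μ := Φ ω) (s := B)]) zero_le_one
  have hpois : ∫⁻ k : ℕ, ENNReal.ofReal (g k)
      ∂poissonMeasure (lam * volume.real B).toNNReal ≤
      ENNReal.ofReal (Real.exp (-(lam * volume.real B))) := by
    calc _ ≤ ∫⁻ k : ℕ, ENNReal.ofReal (0 ^ k)
          ∂poissonMeasure (lam * volume.real B).toNNReal := by
          refine lintegral_mono fun k => ENNReal.ofReal_le_ofReal (max_le ?_ (by positivity))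
          cases k with
          | zero => simp
          | succ k =>
            push_cast
            rw [zero_pow k.succ_ne_zero]
            linarith [Nat.cast_nonneg (α := ℝ) k]
      _ = _ := by
          rw [lintegral_pow_poissonMeasure _ le_rfl, Real.coe_toNNReal _ (by positivity)]
          simp
  calc P {ω | Φ ω B = 0} ≤ ∫⁻ ω, ENNReal.ofReal (g ((Φ ω).real B)) ∂P := by
        refine (measure_mono fun ω hω => ?_).trans ((mul_meas_ge_le_lintegral
          (hgc.measurable.comp (measurable_count hΦ hB.1)).ennreal_ofReal 1).trans_eq' (by
            rw [one_mul]))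
        have hω : Φ ω B = 0 := hω
        simp [hg, measureReal_def, hω]
    _ ≤ _ := (lintegral_count_le hΨ hB (hle 1 (fun _ => B) fun _ => hB) hgc.measurable
        (fun _ => le_max_right _ _)
        ⟨fun x y h => hanti (h 0), isDcx_of_convexOn hconv⟩ hint
        (hpois.trans_lt ENNReal.ofReal_lt_top).ne).trans hpois

end SingleCounts

end SubPoisson

namespace SubPoisson

/-! ### Counting lattice paths -/

section Paths

variable {V : Type*} [DecidableEq V]

/-- The vertex sequences of `n` steps from `v` when `N` lists the possible successors. -/
def pathsFrom (N : V → Finset V) : ℕ → V → Finset (List V)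
  | 0, v => {[v]}
  | n + 1, v => (N v).biUnion fun w => (pathsFrom N n w).image (v :: ·)

lemma card_pathsFrom_le {N : V → Finset V} {K : ℕ} (hN : ∀ v, (N v).card ≤ K) (n : ℕ) (v : V) :
    (pathsFrom N n v).card ≤ K ^ n := by
  induction n generalizing v with
  | zero => simp [pathsFrom]
  | succ n ih =>
    calc (pathsFrom N (n + 1) v).card ≤ (N v).card * K ^ n :=
          Finset.card_biUnion_le_card_mul _ _ _ fun w _ => Finset.card_image_le.trans (ih w)
      _ ≤ K ^ (n + 1) := by
          rw [pow_succ, mul_comm]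
          gcongr
          exact hN v

lemma length_of_mem_pathsFrom {N : V → Finset V} {n : ℕ} {v : V} {l : List V}
    (h : l ∈ pathsFrom N n v) : l.length = n + 1 := by
  induction n generalizing v l with
  | zero => simp_all [pathsFrom]
  | succ n ih =>
    simp only [pathsFrom, Finset.mem_biUnion, Finset.mem_image] at h
    obtain ⟨w, -, l', hl', rfl⟩ := h
    simp [ih hl']

lemma support_mem_pathsFrom {G : SimpleGraph V} {N : V → Finset V}
    (hN : ∀ v w, G.Adj v w → w ∈ N v) {v w : V} (p : G.Walk v w) :
    p.support ∈ pathsFrom N p.length v := by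
  induction p with
  | nil => simp [pathsFrom]
  | cons h p ih =>
    simp only [SimpleGraph.Walk.support_cons, SimpleGraph.Walk.length_cons, pathsFrom,
      Finset.mem_biUnion, Finset.mem_image]
    exact ⟨_, hN _ _ h, _, ih, rfl⟩

end Paths

/-! ### Peierls argument for the lower bound -/

section Subcritical

variable {d : ℕ}

/-- Neighbouring cells of the lattice, diagonals included. -/
noncomputable def neighbours (z : Fin d → ℤ) : Finset (Fin d → ℤ) :=
  Fintype.piFinset fun k => Finset.Icc (z k - 1) (z k + 1)

lemma card_neighbours (z : Fin d → ℤ) : (neighbours z).card = 3 ^ d := by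
  have h : ∀ a : ℤ, a + 1 + 1 - (a - 1) = 3 := fun a => by ring
  simp [neighbours, Fintype.card_piFinset, h]

/-- The graph of the cells charged by `φ`. -/
def occupiedGraph (φ : Measure (Space d)) (s : ℝ) : SimpleGraph (Fin d → ℤ) where
  Adj z w := z ≠ w ∧ φ (cell s z) ≠ 0 ∧ φ (cell s w) ≠ 0 ∧ ∀ k, |z k - w k| ≤ 1
  symm := ⟨fun z w ⟨h1, h2, h3, h4⟩ => ⟨h1.symm, h3, h2, fun k => by rw [abs_sub_comm]; exact h4 k⟩⟩
  loopless := ⟨fun z h => h.1 rfl⟩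

lemma mem_neighbours_of_adj {φ : Measure (Space d)} {s : ℝ} {z w : Fin d → ℤ}
    (h : (occupiedGraph φ s).Adj z w) : w ∈ neighbours z := by
  refine Fintype.mem_piFinset.2 fun k => Finset.mem_Icc.2 ?_
  have := abs_le.1 (h.2.2.2 k)
  omega

lemma abs_sub_le_length {φ : Measure (Space d)} {s : ℝ} {z w : Fin d → ℤ}
    (p : (occupiedGraph φ s).Walk z w) (k : Fin d) : |z k - w k| ≤ p.length := by
  induction p with
  | nil => simp
  | cons h p ih =>
    have h1 := abs_le.1 (h.2.2.2 k)
    rw [abs_le] at ih ⊢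
    push_cast [SimpleGraph.Walk.length_cons]
    omega

lemma occupied_of_mem_support {φ : Measure (Space d)} {s : ℝ} {z w : Fin d → ℤ}
    (p : (occupiedGraph φ s).Walk z w) (hz : φ (cell s z) ≠ 0) :
    ∀ v ∈ p.support, φ (cell s v) ≠ 0 := by
  induction p with
  | nil => simpa using hz
  | cons h p ih =>
    intro v hv
    rw [SimpleGraph.Walk.support_cons, List.mem_cons] at hv
    rcases hv with rfl | hv
    · exact hz
    · exact ih h.2.2.1 v hv

lemma abs_floor_sub_floor_le_one {s a b : ℝ} (hs : 0 < s) (h : |a - b| < s) :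
    |⌊a / s⌋ - ⌊b / s⌋| ≤ 1 := by
  have h1 : |a / s - b / s| < 1 := by
    rw [← sub_div, abs_div, abs_of_pos hs, div_lt_one hs]
    exact h
  rw [abs_lt] at h1
  have h2 := Int.floor_le (a / s)
  have h3 := Int.lt_floor_add_one (a / s)
  have h4 := Int.floor_le (b / s)
  have h5 := Int.lt_floor_add_one (b / s)
  have h6 : (⌊a / s⌋ : ℝ) < ((⌊b / s⌋ + 2 : ℤ) : ℝ) := by push_cast; linarith
  have h7 : (⌊b / s⌋ : ℝ) < ((⌊a / s⌋ + 2 : ℤ) : ℝ) := by push_cast; linarith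
  rw [Int.cast_lt] at h6 h7
  rw [abs_le]
  omega

lemma abs_apply_le_norm (x : Space d) (k : Fin d) : |x k| ≤ ‖x‖ := PiLp.norm_apply_le x k

/-- If the Boolean model of radius less than half the side of the cells percolates, then there are
arbitrarily long self-avoiding paths of charged cells from some cell. -/
lemma exists_paths_of_percolates {φ : Measure (Space d)} {s r : ℝ} (hr : 2 * r < s) (hs : 0 < s)
    (h : Percolates (booleanModel φ r)) :
    ∃ z : Fin d → ℤ, ∀ n, ∃ l ∈ pathsFrom neighbours n z, l.Nodup ∧ ∀ v ∈ l, φ (cell s v) ≠ 0 := by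
  obtain ⟨S, hSC, hS, hSb⟩ := h
  let idx : Space d → Fin d → ℤ := fun x k => ⌊x k / s⌋
  obtain ⟨y₀, hy₀⟩ := hS.nonempty
  obtain ⟨x₀, hx₀, hyx₀⟩ := Set.mem_iUnion₂.1 (hSC hy₀)
  have hocc : ∀ x ∈ points φ, φ (cell s (idx x)) ≠ 0 := fun x hx =>
    measure_ne_zero_of_mem_points hx (mem_cell_floor s x)
  let R : Set (Space d) := {x | x ∈ points φ ∧ (occupiedGraph φ s).Reachable (idx x₀) (idx x)}
  let R' : Set (Space d) := {x | x ∈ points φ ∧ ¬ (occupiedGraph φ s).Reachable (idx x₀) (idx x)}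
  -- Points whose open balls of radius s/2 meet lie in equal or adjacent cells. So the balls around
  -- reachable points and around unreachable points form disjoint open sets covering S, and
  -- connectedness leaves only the first.
  have hSU : S ⊆ ⋃ x ∈ R, Metric.ball x (s / 2) := by
    refine hS.isPreconnected.subset_left_of_subset_union
      (v := ⋃ x ∈ R', Metric.ball x (s / 2))
      (isOpen_biUnion fun _ _ => Metric.isOpen_ball)
      (isOpen_biUnion fun _ _ => Metric.isOpen_ball) ?_ ?_ ?_
    · refine Set.disjoint_left.2 fun y hy hy' => ?_
      obtain ⟨x, hx, hyx⟩ := Set.mem_iUnion₂.1 hy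
      obtain ⟨x', hx', hyx'⟩ := Set.mem_iUnion₂.1 hy'
      refine hx'.2 ?_
      by_cases he : idx x = idx x'
      · rw [← he]
        exact hx.2
      · refine hx.2.trans (SimpleGraph.Adj.reachable
          ⟨he, hocc x hx.1, hocc x' hx'.1, fun k => abs_floor_sub_floor_le_one hs ?_⟩)
        have h1 : dist x x' < s := by
          have := dist_triangle_left x x' y
          rw [Metric.mem_ball] at hyx hyx'
          linarith
        rw [dist_eq_norm] at h1
        exact (abs_apply_le_norm (x - x') k).trans_lt h1
    · intro y hy
      obtain ⟨x, hx, hyx⟩ := Set.mem_iUnion₂.1 (hSC hy)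
      have hyx' : y ∈ Metric.ball x (s / 2) :=
        Metric.closedBall_subset_ball (by linarith) hyx
      by_cases hR : (occupiedGraph φ s).Reachable (idx x₀) (idx x)
      · exact Or.inl (Set.mem_biUnion (show x ∈ R from ⟨hx, hR⟩) hyx')
      · exact Or.inr (Set.mem_biUnion (show x ∈ R' from ⟨hx, hR⟩) hyx')
    · exact ⟨y₀, hy₀, Set.mem_biUnion (show x₀ ∈ R from ⟨hx₀, SimpleGraph.Reachable.rfl⟩)
        (Metric.closedBall_subset_ball (by linarith) hyx₀)⟩
  refine ⟨idx x₀, fun n => ?_⟩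
  -- Otherwise the reachable cells stay within n of the first one and S is bounded. A path to x thus
  -- has at least n steps and can be cut after n.
  obtain ⟨x, hx, k, hk⟩ : ∃ x ∈ R, ∃ k, (n : ℤ) < |idx x₀ k - idx x k| := by
    by_contra! hno
    refine hSb ((Metric.isBounded_iff_subset_closedBall 0).2
      ⟨d * (s * ((∑ k, |(idx x₀ k : ℝ)|) + n + 2)), fun y hy => ?_⟩)
    obtain ⟨x, hx, hyx⟩ := Set.mem_iUnion₂.1 (hSU hy)
    rw [mem_closedBall_zero_iff]
    refine norm_le_of_forall_abs_le (by positivity) fun k => ?_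
    have h1 : |(idx x₀ k : ℝ) - idx x k| ≤ n := by exact_mod_cast hno x hx k
    have h2 := (mem_cell_iff hs).1 (mem_cell_floor s x) k
    have h3 : |(y - x) k| < s / 2 :=
      (abs_apply_le_norm (y - x) k).trans_lt (by rw [← dist_eq_norm]; exact hyx)
    have h4 : |(idx x₀ k : ℝ)| ≤ ∑ k, |(idx x₀ k : ℝ)| :=
      Finset.single_le_sum (f := fun k => |(idx x₀ k : ℝ)|) (fun _ _ => abs_nonneg _)
        (Finset.mem_univ k)
    rw [PiLp.sub_apply] at h3
    change s * (idx x k : ℝ) ≤ x k ∧ x k < s * ((idx x k : ℝ) + 1) at h2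
    rw [abs_le] at h1 ⊢
    rw [abs_lt] at h3
    have h5 : (idx x k : ℝ) ≤ (∑ k, |(idx x₀ k : ℝ)|) + n := by
      linarith [le_abs_self (idx x₀ k : ℝ)]
    have h6 : -(idx x k : ℝ) ≤ (∑ k, |(idx x₀ k : ℝ)|) + n := by
      linarith [neg_le_abs (idx x₀ k : ℝ)]
    have h7 := mul_le_mul_of_nonneg_left h5 hs.le
    have h8 := mul_le_mul_of_nonneg_left h6 hs.le
    constructor <;> nlinarith
  obtain ⟨p, hp⟩ := hx.2.exists_isPath
  have hlen : n ≤ p.length := by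
    have := abs_sub_le_length p k
    omega
  refine ⟨(p.take n).support, ?_, (hp.take n).support_nodup,
    occupied_of_mem_support _ (hocc x₀ hx₀)⟩
  have := support_mem_pathsFrom (fun _ _ => mem_neighbours_of_adj) (p.take n)
  rwa [SimpleGraph.Walk.take_length, min_eq_left hlen] at this

/-- Peierls argument: no percolation when the probability that all cells of a finite set are
charged decays fast enough. -/
lemma measure_percolates_eq_zero {Ω : Type u} [MeasurableSpace Ω] {P : Measure Ω}
    {Φ : Ω → Measure (Space d)} {s r : ℝ} (hs : 0 < s) (hr : 2 * r < s)
    (hP : ∀ A : Finset (Fin d → ℤ), P {ω | ∀ z ∈ A, Φ ω (cell s z) ≠ 0} ≤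
      (2⁻¹ * (3 ^ d)⁻¹) ^ A.card) :
    P {ω | Percolates (booleanModel (Φ ω) r)} = 0 := by
  have hK0 : (3 : ℝ≥0∞) ^ d ≠ 0 := by positivity
  have hKt : (3 : ℝ≥0∞) ^ d ≠ ∞ := by finiteness
  refine measure_mono_null (t := ⋃ z : Fin d → ℤ, {ω | ∀ n, ∃ l ∈ pathsFrom neighbours n z,
    l.Nodup ∧ ∀ v ∈ l, Φ ω (cell s v) ≠ 0})
    (fun ω hω => Set.mem_iUnion.2 (exists_paths_of_percolates hr hs hω))
    (measure_iUnion_null fun z => ?_)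
  have hbound : ∀ n : ℕ, P {ω | ∀ n, ∃ l ∈ pathsFrom neighbours n z,
      l.Nodup ∧ ∀ v ∈ l, Φ ω (cell s v) ≠ 0} ≤ 2⁻¹ ^ n := by
    intro n
    calc _ ≤ P (⋃ l ∈ (pathsFrom neighbours n z).filter List.Nodup,
            {ω | ∀ v ∈ l.toFinset, Φ ω (cell s v) ≠ 0}) := by
          refine measure_mono fun ω hω => ?_
          obtain ⟨l, hl, hnd, hocc⟩ := hω n
          exact Set.mem_biUnion (Finset.mem_coe.2 (Finset.mem_filter.2 ⟨hl, hnd⟩))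
            fun v hv => hocc v (List.mem_toFinset.1 hv)
      _ ≤ ∑ l ∈ (pathsFrom neighbours n z).filter List.Nodup,
            P {ω | ∀ v ∈ l.toFinset, Φ ω (cell s v) ≠ 0} := measure_biUnion_finset_le _ _
      _ ≤ ∑ l ∈ (pathsFrom neighbours n z).filter List.Nodup,
            (2⁻¹ * (3 ^ d : ℝ≥0∞)⁻¹) ^ (n + 1) := by
          refine Finset.sum_le_sum fun l hl => ?_
          rw [Finset.mem_filter] at hl
          have := hP l.toFinset
          rwa [List.toFinset_card_of_nodup hl.2, length_of_mem_pathsFrom hl.1] at this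
      _ ≤ (3 ^ d) ^ n * (2⁻¹ * (3 ^ d : ℝ≥0∞)⁻¹) ^ (n + 1) := by
          rw [Finset.sum_const, nsmul_eq_mul]
          gcongr
          exact_mod_cast (Finset.card_filter_le _ _).trans
            (card_pathsFrom_le (fun v => (card_neighbours v).le) n z)
      -- A path of n steps has n + 1 cells; the spare factor, at most 1, is discarded.
      _ ≤ (3 ^ d) ^ n * (2⁻¹ * (3 ^ d : ℝ≥0∞)⁻¹) ^ n := by
          refine mul_le_mul_right (pow_le_pow_right_of_le_one' (mul_le_one' (by simp) ?_)
            n.le_succ) _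
          exact ENNReal.inv_le_one.2 (one_le_pow₀ (by norm_num))
      _ = 2⁻¹ ^ n := by
          rw [← mul_pow, mul_left_comm, ENNReal.mul_inv_cancel hK0 hKt, mul_one]
  exact le_antisymm (ge_of_tendsto' (ENNReal.tendsto_pow_atTop_nhds_zero_of_lt_one (by simp))
    hbound) zero_le

lemma le_criticalRadius {Ω : Type u} [MeasurableSpace Ω] {P : Measure Ω}
    {Φ : Ω → Measure (Space d)} {s : ℝ} (hs : 0 < s)
    (hP : ∀ A : Finset (Fin d → ℤ), P {ω | ∀ z ∈ A, Φ ω (cell s z) ≠ 0} ≤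
      (2⁻¹ * (3 ^ d)⁻¹) ^ A.card) :
    ENNReal.ofReal (s / 2) ≤ criticalRadius P Φ := by
  refine le_sInf ?_
  rintro _ ⟨r, ⟨-, hperc⟩, rfl⟩
  refine ENNReal.ofReal_le_ofReal (not_lt.1 fun hlt => hperc.ne' ?_)
  exact measure_percolates_eq_zero hs (by linarith) hP

/-- The tail bound at n = |A| with `a = 6 * 3 ^ d`: `hsmall` keeps the exponent per cell at most 1,
and e / (6·3^d) ≤ 3 / (6·3^d) = 1 / (2·3^d). -/
lemma IdcxLE.measure_occupied_le {Ω : Type u} [MeasurableSpace Ω] {P : Measure Ω}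
    [IsFiniteMeasure P] {Φ : Ω → Measure (Space d)} {Ω' : Type v} [MeasurableSpace Ω']
    {Q : Measure Ω'} {Ψ : Ω' → Measure (Space d)} {lam : ℝ} (hlam : 0 ≤ lam)
    (hΦ : IsPointProcess Φ) (hmean : HasLocallyFiniteMean P Φ) (hΨ : IsPoissonProcess Q lam Ψ)
    (hle : IdcxLE P Φ Q Ψ) {s : ℝ} (hs : 0 < s) (hsmall : lam * s ^ d * (6 * 3 ^ d) ≤ 1)
    (A : Finset (Fin d → ℤ)) :
    P {ω | ∀ z ∈ A, Φ ω (cell s z) ≠ 0} ≤ (2⁻¹ * (3 ^ d)⁻¹) ^ A.card := by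
  have h3 : (1 : ℝ) ≤ 3 ^ d := one_le_pow₀ (by norm_num)
  have hη : Real.exp (lam * s ^ d * (6 * 3 ^ d - 1)) / (6 * 3 ^ d) ≤ 2⁻¹ * (3 ^ d)⁻¹ := by
    have h1 : Real.exp (lam * s ^ d * (6 * 3 ^ d - 1)) ≤ 3 := by
      have h2 : 0 ≤ lam * s ^ d := by positivity
      exact (Real.exp_le_exp.2 (by linarith)).trans Real.exp_one_lt_three.le
    rw [div_le_iff₀ (by positivity)]
    refine h1.trans_eq ?_
    field_simp
    norm_num
  calc P {ω | ∀ z ∈ A, Φ ω (cell s z) ≠ 0}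
      ≤ P {ω | (A.card : ℝ≥0∞) ≤ Φ ω (⋃ z ∈ A, cell s z)} := by
        refine measure_mono fun ω hω => ?_
        rw [Set.mem_ofPred_eq, measure_biUnion_cell _ hs]
        calc (A.card : ℝ≥0∞) = ∑ z ∈ A, 1 := by simp
          _ ≤ ∑ z ∈ A, Φ ω (cell s z) := by
            refine Finset.sum_le_sum fun z hz => ?_
            obtain ⟨n, hn⟩ := hΦ.natValued ω _ (isBddBorel_cell hs z)
            have := hω z hz
            rw [hn] at this ⊢
            exact_mod_cast Nat.one_le_iff_ne_zero.2 (by exact_mod_cast this)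
    _ ≤ _ := hle.measure_count_ge_le hlam hΦ hmean hΨ (isBddBorel_biUnion_cell hs A) A.card
        (a := 6 * 3 ^ d) (by linarith)
    _ = ENNReal.ofReal ((Real.exp (lam * s ^ d * (6 * 3 ^ d - 1)) / (6 * 3 ^ d)) ^ A.card) := by
        rw [volume_real_biUnion_cell hs, div_pow, ← Real.exp_nat_mul]
        ring_nf
    _ ≤ ENNReal.ofReal ((2⁻¹ * (3 ^ d)⁻¹) ^ A.card) := by gcongr
    _ = _ := by
        rw [ENNReal.ofReal_pow (by positivity), ENNReal.ofReal_mul (by positivity),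
          ENNReal.ofReal_inv_of_pos (by positivity), ENNReal.ofReal_inv_of_pos (by positivity),
          ENNReal.ofReal_pow (by positivity)]
        simp

/-- When all cells are charged the product of their counts is at least 1, so Markov's inequality and
the joint intensity give (λ s^d)^|A|. The empty set is separate because intensities are given only
for k ≥ 1. -/
lemma IsWeaklySubPoisson.measure_occupied_le {Ω : Type u} [MeasurableSpace Ω] {P : Measure Ω}
    [IsProbabilityMeasure P] {Φ : Ω → Measure (Space d)} {lam : ℝ}
    (hΦ : IsPointProcess Φ) (hlam : 0 ≤ lam) (h : IsWeaklySubPoisson P lam Φ) {s : ℝ} (hs : 0 < s)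
    (hsmall : lam * s ^ d * (6 * 3 ^ d) ≤ 1) (A : Finset (Fin d → ℤ)) :
    P {ω | ∀ z ∈ A, Φ ω (cell s z) ≠ 0} ≤ (2⁻¹ * (3 ^ d)⁻¹) ^ A.card := by
  rcases Nat.eq_zero_or_pos A.card with hA | hA
  · simpa [hA] using prob_le_one
  obtain ⟨ρ, ⟨-, hρ⟩, hle⟩ := h A.card hA
  let e := A.equivFin.symm
  let B : Fin A.card → Set (Space d) := fun i => cell s (e i : Fin d → ℤ)
  have hB : Pairwise fun i j => Disjoint (B i) (B j) := fun i j hij =>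
    pairwise_disjoint_cell s fun h => hij (e.injective (Subtype.ext h))
  have hη : ENNReal.ofReal lam * ENNReal.ofReal (s ^ d) ≤ 2⁻¹ * (3 ^ d)⁻¹ := by
    rw [← ENNReal.ofReal_mul' (by positivity)]
    calc ENNReal.ofReal (lam * s ^ d) ≤ ENNReal.ofReal (2⁻¹ * (3 ^ d)⁻¹) := by
          refine ENNReal.ofReal_le_ofReal ?_
          rw [← mul_inv, ← one_div, le_div_iff₀ (by positivity)]
          have : 0 ≤ lam * s ^ d * (4 * 3 ^ d) := by positivity
          linarith
      _ = _ := by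
          rw [ENNReal.ofReal_mul (by positivity), ENNReal.ofReal_inv_of_pos (by positivity),
            ENNReal.ofReal_inv_of_pos (by positivity), ENNReal.ofReal_pow (by positivity)]
          simp
  calc P {ω | ∀ z ∈ A, Φ ω (cell s z) ≠ 0} ≤ ∫⁻ ω, ∏ i, Φ ω (B i) ∂P := by
        refine (measure_mono fun ω hω => ?_).trans ((mul_meas_ge_le_lintegral
          (Finset.measurable_prod _ fun i _ =>
            (Measure.measurable_coe (measurableSet_cell hs _)).comp hΦ.measurable) 1).trans_eq' (by
            rw [one_mul]))
        rw [Set.mem_ofPred_eq]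
        refine Finset.one_le_prod' fun i _ => ?_
        obtain ⟨n, hn⟩ := hΦ.natValued ω _ (isBddBorel_cell hs (e i : Fin d → ℤ))
        have := hω _ (e i).2
        simp only [Function.comp]
        rw [hn] at this ⊢
        exact_mod_cast Nat.one_le_iff_ne_zero.2 (by exact_mod_cast this)
    _ = ∫⁻ x in Set.univ.pi B, ρ x := hρ B (fun i => isBddBorel_cell hs _) hB
    _ ≤ ∫⁻ _x in Set.univ.pi B, ENNReal.ofReal lam ^ A.card :=
        lintegral_mono_ae (ae_restrict_of_ae hle)
    _ = (ENNReal.ofReal lam * ENNReal.ofReal (s ^ d)) ^ A.card := by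
        rw [setLIntegral_const, volume_pi_pi]
        simp [B, volume_cell hs, mul_pow]
    _ ≤ _ := by gcongr

end Subcritical

end SubPoisson

namespace SubPoisson

/-! ### Hierarchical good boxes in the quadrant -/

section Renormalization

/-- The subboxes of a box, indexed by `{0, 1, 2}²`. -/
def subbox (p u : ℕ × ℕ) : ℕ × ℕ := (3 * p.1 + u.1, 3 * p.2 + u.2)

/-- A box of level `0` is good if it is open; a box of level `k + 1` is good if at most one of
its nine subboxes of level `k` is not good. -/
def IsGood (O : Set (ℕ × ℕ)) : ℕ → ℕ × ℕ → Prop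
  | 0, p => p ∈ O
  | k + 1, p => ∃ e : ℕ × ℕ, ∀ a < 3, ∀ b < 3, (a, b) ≠ e → IsGood O k (subbox p (a, b))

/-- The open sites in a good box that are reached through good subboxes of all levels. -/
def cluster (O : Set (ℕ × ℕ)) : ℕ → ℕ × ℕ → Set (ℕ × ℕ)
  | 0, p => {p}
  | k + 1, p => {z | ∃ a < 3, ∃ b < 3,
      IsGood O k (subbox p (a, b)) ∧ z ∈ cluster O k (subbox p (a, b))}

variable {O : Set (ℕ × ℕ)}

/-- At most one subbox is bad, so the right-hand column contains a good one at every level. The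
inequality places the site in the last column of the box, which later gives unboundedness. -/
lemma exists_mem_cluster {k : ℕ} {p : ℕ × ℕ} (h : IsGood O k p) :
    ∃ z ∈ cluster O k p, z ∈ O ∧ 3 ^ k * (p.1 + 1) ≤ z.1 + 1 := by
  induction k generalizing p with
  | zero => exact ⟨p, rfl, h, by simp⟩
  | succ k ih =>
    obtain ⟨e, he⟩ := h
    obtain ⟨b, hb, hbe⟩ : ∃ b < 3, b ≠ e.2 := by
      by_cases h0 : e.2 = 0
      · exact ⟨1, by norm_num, by omega⟩
      · exact ⟨0, by norm_num, by omega⟩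
    have hg := he 2 (by norm_num) b hb fun h => hbe (congrArg Prod.snd h)
    obtain ⟨z, hz, hzO, hle⟩ := ih hg
    refine ⟨z, ⟨2, by norm_num, b, hb, hg, hz⟩, hzO, ?_⟩
    calc 3 ^ (k + 1) * (p.1 + 1) = 3 ^ k * ((subbox p (2, b)).1 + 1) := by
          simp only [subbox]
          ring
      _ ≤ z.1 + 1 := hle

lemma IsGood.exists_iff {k : ℕ} {p : ℕ × ℕ} (h : IsGood O (k + 1) p) :
    ∃ e : ℕ × ℕ, ∀ a < 3, ∀ b < 3, IsGood O k (subbox p (a, b)) ↔ (a, b) ≠ e := by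
  obtain ⟨e, he⟩ := h
  by_cases hg : IsGood O k (subbox p e)
  -- An index outside the grid encodes that no subbox is bad.
  · refine ⟨(3, 3), fun a ha b hb => iff_of_true ?_ fun h => ?_⟩
    · by_cases hab : (a, b) = e
      · rwa [hab]
      · exact he a ha b hb hab
    · exact ha.ne (congrArg Prod.fst h)
  · refine ⟨e, fun a ha b hb => ⟨fun h hab => hg (hab ▸ h), he a ha b hb⟩⟩

/-- A three by three grid with at most one site removed is connected. -/
lemma grid_connected {T : ℕ × ℕ → ℕ × ℕ → Prop} (hsymm : ∀ u v, T u v → T v u)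
    (htrans : ∀ u v w, T u v → T v w → T u w) {g : ℕ × ℕ → Prop} {e : ℕ × ℕ}
    (hg : ∀ a < 3, ∀ b < 3, g (a, b) ↔ (a, b) ≠ e)
    (hr : ∀ a b, g (a, b) → g (a + 1, b) → T (a, b) (a + 1, b))
    (hu : ∀ a b, g (a, b) → g (a, b + 1) → T (a, b) (a, b + 1))
    {a b a' b' : ℕ} (ha : a < 3) (hb : b < 3) (ha' : a' < 3) (hb' : b' < 3)
    (h : g (a, b)) (h' : g (a', b')) : T (a, b) (a', b') := by
  have line : ∀ f : ℕ → ℕ × ℕ, T (f 0) (f 1) → T (f 1) (f 2) →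
      ∀ i < 3, ∀ j < 3, T (f i) (f j) := by
    intro f h01 h12 i hi j hj
    have h1 : ∀ i < 3, T (f i) (f 1) := by
      intro i hi
      interval_cases i
      exacts [h01, htrans _ _ _ (hsymm _ _ h01) h01, hsymm _ _ h12]
    exact htrans _ _ _ (h1 i hi) (hsymm _ _ (h1 j hj))
  have row : ∀ b < 3, b ≠ e.2 → ∀ i < 3, ∀ j < 3, T (i, b) (j, b) := by
    intro b hb hbe
    have hgb : ∀ a < 3, g (a, b) := fun a ha => (hg a ha b hb).2 fun h => hbe (congrArg Prod.snd h)
    exact line (fun i => (i, b)) (hr 0 b (hgb 0 (by norm_num)) (hgb 1 (by norm_num)))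
      (hr 1 b (hgb 1 (by norm_num)) (hgb 2 (by norm_num)))
  have col : ∀ a < 3, a ≠ e.1 → ∀ i < 3, ∀ j < 3, T (a, i) (a, j) := by
    intro a ha hae
    have hga : ∀ b < 3, g (a, b) := fun b hb => (hg a ha b hb).2 fun h => hae (congrArg Prod.fst h)
    exact line (fun i => (a, i)) (hu a 0 (hga 0 (by norm_num)) (hga 1 (by norm_num)))
      (hu a 1 (hga 1 (by norm_num)) (hga 2 (by norm_num)))
  have avoid : ∀ n : ℕ, ∃ i < 3, i ≠ n := fun n => by
    by_cases h0 : n = 0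
    · exact ⟨1, by norm_num, by omega⟩
    · exact ⟨0, by norm_num, by omega⟩
  -- The site (i, j) lies off the row and the column of e, so both its lines are intact. Every
  -- remaining site has an intact row or column, which leads to one of these lines.
  obtain ⟨i, hi, hie⟩ := avoid e.1
  obtain ⟨j, hj, hje⟩ := avoid e.2
  have hub : ∀ a < 3, ∀ b < 3, g (a, b) → T (a, b) (i, j) := by
    intro a ha b hb h
    by_cases hbe : b = e.2
    · have hae : a ≠ e.1 := fun hae => (hg a ha b hb).1 h (Prod.ext hae hbe)
      exact htrans _ _ _ (col a ha hae b hb j hj) (row j hj hje a ha i hi)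
    · exact htrans _ _ _ (row b hb hbe a ha i hi) (col i hi hie b hb j hj)
  exact htrans _ _ _ (hub a ha b hb h) (hsymm _ _ (hub a' ha' b' hb' h'))

/-- The clusters of equal or neighbouring good boxes are connected to each other. -/
lemma cluster_connected {r : ℕ × ℕ → ℕ × ℕ → Prop} (hsymm : ∀ z w, r z w → r w z)
    (htrans : ∀ z w v, r z w → r w v → r z v)
    (hrefl : ∀ z ∈ O, r z z)
    (hr : ∀ a b, (a, b) ∈ O → (a + 1, b) ∈ O → r (a, b) (a + 1, b))
    (hu : ∀ a b, (a, b) ∈ O → (a, b + 1) ∈ O → r (a, b) (a, b + 1))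
    (k : ℕ) {p q : ℕ × ℕ} (hp : IsGood O k p) (hq : IsGood O k q)
    (hpq : q = p ∨ q = (p.1 + 1, p.2) ∨ q = (p.1, p.2 + 1)) :
    ∀ z ∈ cluster O k p, ∀ w ∈ cluster O k q, r z w := by
  induction k generalizing p q with
  | zero =>
    rintro z rfl w rfl
    rcases hpq with rfl | rfl | rfl
    exacts [hrefl _ hp, hr _ _ hp hq, hu _ _ hp hq]
  | succ k ih =>
    -- Goodness is part of the relation so that the middle cluster is nonempty in transitivity.
    let T : ℕ × ℕ → ℕ × ℕ → Prop := fun u v =>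
      IsGood O k u ∧ IsGood O k v ∧ ∀ z ∈ cluster O k u, ∀ w ∈ cluster O k v, r z w
    have Tsymm : ∀ u v, T u v → T v u := fun u v h =>
      ⟨h.2.1, h.1, fun z hz w hw => hsymm _ _ (h.2.2 w hw z hz)⟩
    have Ttrans : ∀ u v w, T u v → T v w → T u w := fun u v w h h' => by
      obtain ⟨y, hy, -⟩ := exists_mem_cluster h.2.1
      exact ⟨h.1, h'.2.1, fun z hz x hx => htrans _ _ _ (h.2.2 z hz y hy) (h'.2.2 y hy x hx)⟩
    have Tadj : ∀ u v, IsGood O k u → IsGood O k v →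
        (v = u ∨ v = (u.1 + 1, u.2) ∨ v = (u.1, u.2 + 1)) → T u v := fun u v hu hv huv =>
      ⟨hu, hv, ih hu hv huv⟩
    have inside : ∀ {p}, IsGood O (k + 1) p → ∀ {a b a' b' : ℕ}, a < 3 → b < 3 → a' < 3 → b' < 3 →
        IsGood O k (subbox p (a, b)) → IsGood O k (subbox p (a', b')) →
        T (subbox p (a, b)) (subbox p (a', b')) := by
      intro p hp a b a' b' ha hb ha' hb' h h'
      obtain ⟨e, he⟩ := hp.exists_iff
      exact grid_connected (T := fun u v => T (subbox p u) (subbox p v))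
        (g := fun u => IsGood O k (subbox p u)) (fun u v => Tsymm _ _) (fun u v w => Ttrans _ _ _) he
        (fun a b h h' => Tadj _ _ h h' (Or.inr (Or.inl rfl)))
        (fun a b h h' => Tadj _ _ h h' (Or.inr (Or.inr rfl))) ha hb ha' hb' h h'
    -- Three subboxes face each other across a common side and each box spoils at most one position,
    -- so some facing pair is good. This fixes the scale factor 3.
    have avoid : ∀ m n : ℕ, ∃ i < 3, i ≠ m ∧ i ≠ n := fun m n => by
      by_cases h0 : m = 0 ∨ n = 0
      · by_cases h1 : m = 1 ∨ n = 1
        · exact ⟨2, by norm_num, by omega⟩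
        · exact ⟨1, by norm_num, by omega⟩
      · exact ⟨0, by norm_num, by omega⟩
    rintro z ⟨a, ha, b, hb, hg, hz⟩ w ⟨a', ha', b', hb', hg', hw⟩
    obtain ⟨e, he⟩ := hp
    obtain ⟨e', he'⟩ := hq
    have hp : IsGood O (k + 1) p := ⟨e, he⟩
    have hq : IsGood O (k + 1) q := ⟨e', he'⟩
    suffices T (subbox p (a, b)) (subbox q (a', b')) from this.2.2 z hz w hw
    rcases hpq with rfl | rfl | rfl
    · exact inside hp ha hb ha' hb' hg hg'
    · obtain ⟨y, hy, h1, h2⟩ := avoid e.2 e'.2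
      have g1 := he 2 (by norm_num) y hy fun h => h1 (congrArg Prod.snd h)
      have g2 := he' 0 (by norm_num) y hy fun h => h2 (congrArg Prod.snd h)
      exact Ttrans _ _ _ (inside hp ha hb (by norm_num) hy hg g1)
        (Ttrans _ _ _ (Tadj _ _ g1 g2 (Or.inr (Or.inl rfl)))
          (inside hq (by norm_num) hy ha' hb' g2 hg'))
    · obtain ⟨x, hx, h1, h2⟩ := avoid e.1 e'.1
      have g1 := he x hx 2 (by norm_num) fun h => h1 (congrArg Prod.fst h)
      have g2 := he' x hx 0 (by norm_num) fun h => h2 (congrArg Prod.fst h)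
      exact Ttrans _ _ _ (inside hp ha hb hx (by norm_num) hg g1)
        (Ttrans _ _ _ (Tadj _ _ g1 g2 (Or.inr (Or.inr rfl)))
          (inside hq hx (by norm_num) ha' hb' g2 hg'))

/-- If all boxes at the origin are good, then the origin is connected to open sites arbitrarily
far away. -/
lemma exists_far_of_isGood {r : ℕ × ℕ → ℕ × ℕ → Prop} (hsymm : ∀ z w, r z w → r w z)
    (htrans : ∀ z w v, r z w → r w v → r z v)
    (hrefl : ∀ z ∈ O, r z z)
    (hr : ∀ a b, (a, b) ∈ O → (a + 1, b) ∈ O → r (a, b) (a + 1, b))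
    (hu : ∀ a b, (a, b) ∈ O → (a, b + 1) ∈ O → r (a, b) (a, b + 1))
    (hgood : ∀ k, IsGood O k (0, 0)) (n : ℕ) : ∃ z ∈ O, n ≤ z.1 ∧ r (0, 0) z := by
  have h0 : ∀ k, (0, 0) ∈ cluster O k (0, 0) := by
    intro k
    induction k with
    | zero => rfl
    | succ k ih => exact ⟨0, by norm_num, 0, by norm_num, hgood k, ih⟩
  obtain ⟨z, hz, hzO, hle⟩ := exists_mem_cluster (hgood n)
  refine ⟨z, hzO, ?_, cluster_connected hsymm htrans hrefl hr hu n (hgood n) (hgood n)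
    (Or.inl rfl) _ (h0 n) _ hz⟩
  have : n < 3 ^ n := Nat.lt_pow_self (by norm_num)
  simp only [zero_add, mul_one] at hle
  omega

/-- The configurations of closed sites that witness that a box is not good. -/
def badFamily : ℕ → ℕ × ℕ → Finset (Finset (ℕ × ℕ))
  | 0, p => {{p}}
  | k + 1, p => (Finset.range 3 ×ˢ Finset.range 3).offDiag.biUnion fun uv =>
      Finset.image₂ (· ∪ ·) (badFamily k (subbox p uv.1)) (badFamily k (subbox p uv.2))

lemma exists_mem_badFamily {k : ℕ} {p : ℕ × ℕ} (h : ¬ IsGood O k p) :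
    ∃ A ∈ badFamily k p, ∀ z ∈ A, z ∉ O := by
  induction k generalizing p with
  | zero => exact ⟨{p}, by simp [badFamily], by simpa [IsGood] using h⟩
  | succ k ih =>
    have hbad : ∀ e : ℕ × ℕ, ∃ a < 3, ∃ b < 3, (a, b) ≠ e ∧ ¬ IsGood O k (subbox p (a, b)) := by
      intro e
      by_contra! hno
      exact h ⟨e, hno⟩
    obtain ⟨a, ha, b, hb, -, hg⟩ := hbad (0, 0)
    obtain ⟨a', ha', b', hb', hne, hg'⟩ := hbad (a, b)
    obtain ⟨A, hA, hAO⟩ := ih hg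
    obtain ⟨A', hA', hAO'⟩ := ih hg'
    refine ⟨A ∪ A', Finset.mem_biUnion.2 ⟨((a, b), (a', b')), ?_,
      Finset.mem_image₂_of_mem hA hA'⟩, fun z hz => (Finset.mem_union.1 hz).elim (hAO z) (hAO' z)⟩
    simp only [Finset.mem_offDiag, Finset.mem_product, Finset.mem_range]
    exact ⟨⟨ha, hb⟩, ⟨ha', hb'⟩, hne.symm⟩

/-- A choice of two subboxes costs at most 81, so N(k+1) ≤ 81 N(k)²; the extra factor 81 turns this
into plain squaring. -/
lemma card_badFamily_le (k : ℕ) (p : ℕ × ℕ) : 81 * (badFamily k p).card ≤ 81 ^ 2 ^ k := by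
  induction k generalizing p with
  | zero => simp [badFamily]
  | succ k ih =>
    have h1 : ∀ uv : (ℕ × ℕ) × (ℕ × ℕ), 81 * 81 * (Finset.image₂ (· ∪ ·)
        (badFamily k (subbox p uv.1)) (badFamily k (subbox p uv.2))).card ≤ 81 ^ 2 ^ (k + 1) := by
      intro uv
      calc _ ≤ 81 * 81 * ((badFamily k (subbox p uv.1)).card *
            (badFamily k (subbox p uv.2)).card) := by
            gcongr
            exact Finset.card_image₂_le _ _ _
        _ = (81 * (badFamily k (subbox p uv.1)).card) *
            (81 * (badFamily k (subbox p uv.2)).card) := by ring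
        _ ≤ 81 ^ 2 ^ k * 81 ^ 2 ^ k := Nat.mul_le_mul (ih _) (ih _)
        _ = 81 ^ 2 ^ (k + 1) := by rw [← pow_add]; ring_nf
    have h2 : (Finset.range 3 ×ˢ Finset.range 3).offDiag.card ≤ 81 := by decide
    calc 81 * (badFamily (k + 1) p).card
        ≤ 81 * ∑ uv ∈ (Finset.range 3 ×ˢ Finset.range 3).offDiag, (Finset.image₂ (· ∪ ·)
          (badFamily k (subbox p uv.1)) (badFamily k (subbox p uv.2))).card := by
          gcongr
          exact Finset.card_biUnion_le
      _ ≤ 81 ^ 2 ^ (k + 1) := by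
          refine Nat.le_of_mul_le_mul_left (?_ : 81 * _ ≤ 81 * _) (by norm_num)
          rw [← mul_assoc, Finset.mul_sum]
          refine (Finset.sum_le_card_nsmul _ _ _ fun uv _ => h1 uv).trans ?_
          rw [smul_eq_mul]
          gcongr

/-- The quotients locate the witness inside its box; witnesses from distinct subboxes are therefore
disjoint, and the cardinality doubles exactly. -/
lemma div_eq_of_mem_badFamily {k : ℕ} {p : ℕ × ℕ} {A : Finset (ℕ × ℕ)} (hA : A ∈ badFamily k p) :
    A.card = 2 ^ k ∧ ∀ z ∈ A, (z.1 / 3 ^ k, z.2 / 3 ^ k) = p := by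
  induction k generalizing p A with
  | zero =>
    obtain rfl : A = {p} := by simpa [badFamily] using hA
    simp
  | succ k ih =>
    simp only [badFamily, Finset.mem_biUnion, Finset.mem_image₂, Finset.mem_offDiag,
      Finset.mem_product, Finset.mem_range] at hA
    obtain ⟨⟨u, v⟩, ⟨⟨hu1, hu2⟩, ⟨hv1, hv2⟩, huv⟩, B, hB, B', hB', rfl⟩ := hA
    dsimp only at hu1 hu2 hv1 hv2 huv hB hB'
    obtain ⟨hc, hd⟩ := ih hB
    obtain ⟨hc', hd'⟩ := ih hB'
    constructor
    · rw [Finset.card_union_of_disjoint, hc, hc', pow_succ, mul_two]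
      refine Finset.disjoint_left.2 fun z hz hz' => huv ?_
      have h := (hd z hz).symm.trans (hd' z hz')
      simp only [subbox, Prod.mk.injEq] at h
      exact Prod.ext (by omega) (by omega)
    · intro z hz
      have key : ∀ u : ℕ × ℕ, u.1 < 3 → u.2 < 3 →
          (z.1 / 3 ^ k, z.2 / 3 ^ k) = subbox p u → (z.1 / 3 ^ (k + 1), z.2 / 3 ^ (k + 1)) = p := by
        intro u h1 h2 h
        rw [pow_succ, ← Nat.div_div_eq_div_mul, ← Nat.div_div_eq_div_mul]
        simp only [subbox, Prod.mk.injEq] at h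
        rw [h.1, h.2]
        exact Prod.ext (by dsimp only; omega) (by dsimp only; omega)
      rcases Finset.mem_union.1 hz with hz | hz
      · exact key u hu1 hu2 (hd z hz)
      · exact key v hv1 hv2 (hd' z hz)

/-- Level k fails with probability at most (81/243)^(2^k) ≤ 3^(-(k+1)), and these bounds sum to 1/2.
-/
lemma measure_exists_not_isGood_lt_one {Ω : Type*} [MeasurableSpace Ω] {P : Measure Ω}
    (O : Ω → Set (ℕ × ℕ))
    (hP : ∀ A : Finset (ℕ × ℕ), P {ω | ∀ z ∈ A, z ∉ O ω} ≤ (243⁻¹ : ℝ≥0∞) ^ A.card) :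
    P {ω | ∃ k, ¬ IsGood (O ω) k (0, 0)} < 1 := by
  have h243 : (81 : ℝ≥0∞) * 243⁻¹ = 3⁻¹ := by
    rw [show (243 : ℝ≥0∞) = 81 * 3 by norm_num, ENNReal.mul_inv (by norm_num) (by norm_num),
      ← mul_assoc, ENNReal.mul_inv_cancel (by norm_num) (by norm_num), one_mul]
  have hk : ∀ k, P {ω | ¬ IsGood (O ω) k (0, 0)} ≤ 3⁻¹ ^ (k + 1) := by
    intro k
    calc _ ≤ P (⋃ A ∈ badFamily k (0, 0), {ω | ∀ z ∈ A, z ∉ O ω}) := by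
          refine measure_mono fun ω hω => ?_
          obtain ⟨A, hA, hAO⟩ := exists_mem_badFamily hω
          exact Set.mem_biUnion (Finset.mem_coe.2 hA) hAO
      _ ≤ ∑ A ∈ badFamily k (0, 0), P {ω | ∀ z ∈ A, z ∉ O ω} := measure_biUnion_finset_le _ _
      _ ≤ ∑ A ∈ badFamily k (0, 0), (243⁻¹ : ℝ≥0∞) ^ 2 ^ k :=
          Finset.sum_le_sum fun A hA => (hP A).trans_eq (by rw [(div_eq_of_mem_badFamily hA).1])
      _ ≤ 81 ^ 2 ^ k * (243⁻¹ : ℝ≥0∞) ^ 2 ^ k := by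
          rw [Finset.sum_const, nsmul_eq_mul]
          gcongr
          exact_mod_cast (Nat.le_mul_of_pos_left _ (by norm_num)).trans (card_badFamily_le k (0, 0))
      _ = 3⁻¹ ^ 2 ^ k := by rw [← mul_pow, h243]
      _ ≤ 3⁻¹ ^ (k + 1) := by
          refine pow_le_pow_right_of_le_one' ?_ Nat.lt_two_pow_self
          exact ENNReal.inv_le_one.2 (by norm_num)
  calc P {ω | ∃ k, ¬ IsGood (O ω) k (0, 0)} = P (⋃ k, {ω | ¬ IsGood (O ω) k (0, 0)}) := by
        congr 1
        ext ω
        simp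
    _ ≤ ∑' k : ℕ, (3⁻¹ : ℝ≥0∞) ^ (k + 1) := (measure_iUnion_le _).trans (ENNReal.tsum_le_tsum hk)
    _ = 3⁻¹ * (1 - 3⁻¹)⁻¹ := ENNReal.tsum_geometric_add_one _
    _ < 1 := by
        have h1 : (1 : ℝ≥0∞) - 3⁻¹ = ENNReal.ofReal (2 / 3) := by
          rw [← ENNReal.ofReal_one, ← ENNReal.ofReal_ofNat 3,
            ← ENNReal.ofReal_inv_of_pos (by norm_num), ← ENNReal.ofReal_sub _ (by norm_num)]
          norm_num
        rw [h1, ← ENNReal.ofReal_ofNat 3, ← ENNReal.ofReal_inv_of_pos (by norm_num),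
          ← ENNReal.ofReal_inv_of_pos (by norm_num), ← ENNReal.ofReal_mul (by norm_num),
          ← ENNReal.ofReal_one, ENNReal.ofReal_lt_ofReal_iff (by norm_num)]
        norm_num

end Renormalization

/-! ### Percolation at large radius -/

section Supercritical

variable {d : ℕ}

/-- The cells that meet a coordinate quadrant. -/
def planeIndex (p : ℕ × ℕ) (k : Fin d) : ℤ :=
  if k.val = 0 then p.1 else if k.val = 1 then p.2 else 0

lemma planeIndex_injective (hd : 2 ≤ d) : Function.Injective (planeIndex (d := d)) := by
  intro p q h
  have h0 := congrFun h ⟨0, by omega⟩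
  have h1 := congrFun h ⟨1, by omega⟩
  simp only [planeIndex, if_true, one_ne_zero, if_false, Nat.cast_inj] at h0 h1
  exact Prod.ext h0 h1

lemma dist_le_of_mem_cell {s : ℝ} (hs : 0 < s) {z w : Fin d → ℤ} (hzw : ∀ k, |z k - w k| ≤ 1)
    {x y : Space d} (hx : x ∈ cell s z) (hy : y ∈ cell s w) : dist x y ≤ d * (2 * s) := by
  rw [dist_eq_norm]
  refine norm_le_of_forall_abs_le (by positivity) fun k => ?_
  have h1 := (mem_cell_iff hs).1 hx k
  have h2 := (mem_cell_iff hs).1 hy k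
  have h3 : |(z k : ℝ) - w k| ≤ 1 := by exact_mod_cast hzw k
  rw [abs_le] at h3
  rw [PiLp.sub_apply, abs_le]
  constructor <;> nlinarith

lemma mem_connectedComponentIn_booleanModel {φ : Measure (Space d)} {R : ℝ} {x y : Space d}
    (hx : x ∈ points φ) (hR : dist x y ≤ R) :
    y ∈ connectedComponentIn (booleanModel φ R) x := by
  have hR0 : 0 ≤ R := dist_nonneg.trans hR
  have hpre : ∀ z : Space d, IsPreconnected (Metric.closedBall z R) := fun z =>
    (convex_closedBall z R).isPreconnected
  have hy' : y ∈ Metric.closedBall x R := by rwa [Metric.mem_closedBall, dist_comm]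
  exact (hpre x).subset_connectedComponentIn (Metric.mem_closedBall_self hR0)
    (Set.subset_biUnion_of_mem (u := fun x => Metric.closedBall x R) hx) hy'

lemma percolates_of_isGood {φ : Measure (Space d)} (hd : 2 ≤ d)
    (hφ : ∀ B : Set (Space d), IsBddBorel B → ∃ n : ℕ, φ B = n) {s : ℝ} (hs : 0 < s)
    (hgood : ∀ k, IsGood {p | φ (cell s (planeIndex p)) ≠ 0} k (0, 0)) :
    Percolates (booleanModel φ (d * (2 * s))) := by
  set O : Set (ℕ × ℕ) := {p | φ (cell s (planeIndex p)) ≠ 0} with hO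
  set C := booleanModel φ (d * (2 * s)) with hC
  -- Quantifying over all points of both cells makes the relation compose: any point of the middle
  -- charged cell can be the link. The radius exceeds the distance between points of adjacent cells.
  let r : ℕ × ℕ → ℕ × ℕ → Prop := fun z w => z ∈ O ∧ w ∈ O ∧
    ∀ x ∈ points φ, x ∈ cell s (planeIndex z) → ∀ y ∈ points φ, y ∈ cell s (planeIndex w) →
      y ∈ connectedComponentIn C x
  have hmem : ∀ x ∈ points φ, x ∈ C := fun x hx =>
    Set.mem_biUnion hx (Metric.mem_closedBall_self (by positivity))
  have hadj : ∀ z ∈ O, ∀ w ∈ O, (∀ k : Fin d, |planeIndex z k - planeIndex w k| ≤ 1) → r z w :=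
    fun z hz w hw hzw => ⟨hz, hw, fun x hx hxz y _ hyw =>
      mem_connectedComponentIn_booleanModel hx (dist_le_of_mem_cell hs hzw hxz hyw)⟩
  have hsymm : ∀ z w, r z w → r w z := fun z w h => ⟨h.2.1, h.1, fun x hx hxw y hy hyz => by
    rw [← connectedComponentIn_eq (h.2.2 y hy hyz x hx hxw)]
    exact mem_connectedComponentIn (hmem y hy)⟩
  have htrans : ∀ z w v, r z w → r w v → r z v := fun z w v h h' =>
    ⟨h.1, h'.2.1, fun x hx hxz y hy hyv => by
      obtain ⟨u, huw, hu⟩ := exists_mem_points hφ h.2.1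
      rw [connectedComponentIn_eq (h.2.2 x hx hxz u hu huw)]
      exact h'.2.2 u hu huw y hy hyv⟩
  have hfar := exists_far_of_isGood hsymm htrans
    (fun z hz => hadj z hz z hz fun k => by simp)
    (fun a b h h' => hadj _ h _ h' fun k => by
      simp only [planeIndex]
      split_ifs <;> simp)
    (fun a b h h' => hadj _ h _ h' fun k => by
      simp only [planeIndex]
      split_ifs <;> simp) hgood
  obtain ⟨x₀, hx₀z, hx₀⟩ := exists_mem_points hφ (hgood 0)
  refine ⟨connectedComponentIn C x₀, connectedComponentIn_subset C x₀,
    isConnected_connectedComponentIn_iff.2 (hmem x₀ hx₀), fun hb => ?_⟩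
  obtain ⟨M, hM⟩ := (Metric.isBounded_iff_subset_closedBall 0).1 hb
  obtain ⟨n, hn⟩ := exists_nat_gt (M / s)
  obtain ⟨z, hzO, hnz, hrz⟩ := hfar n
  obtain ⟨y, hyz, hy⟩ := exists_mem_points hφ hzO
  have h1 := mem_closedBall_zero_iff.1 (hM (hrz.2.2 x₀ hx₀ hx₀z y hy hyz))
  have h2 := ((mem_cell_iff hs).1 hyz ⟨0, by omega⟩).1
  simp only [planeIndex, if_true, Int.cast_natCast] at h2
  have h3 : (n : ℝ) ≤ z.1 := by exact_mod_cast hnz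
  have h4 := (le_abs_self _).trans (abs_apply_le_norm y ⟨0, by omega⟩)
  rw [div_lt_iff₀ hs] at hn
  nlinarith

lemma DdcxLE.measure_empty_le {Ω : Type u} [MeasurableSpace Ω] {P : Measure Ω}
    [IsFiniteMeasure P] {Φ : Ω → Measure (Space d)} {Ω' : Type v} [MeasurableSpace Ω']
    {Q : Measure Ω'} {Ψ : Ω' → Measure (Space d)} {lam : ℝ} (hlam : 0 ≤ lam)
    (hΦ : IsPointProcess Φ) (hΨ : IsPoissonProcess Q lam Ψ)
    (hle : DdcxLE P Φ Q Ψ) {s : ℝ} (hs : 0 < s) (hlarge : 6 ≤ lam * s ^ d)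
    (A : Finset (Fin d → ℤ)) :
    P {ω | ∀ z ∈ A, Φ ω (cell s z) = 0} ≤ (243⁻¹ : ℝ≥0∞) ^ A.card := by
  have h1 : Real.exp (-(lam * s ^ d)) ≤ 243⁻¹ := by
    rw [Real.exp_neg]
    refine inv_anti₀ (by norm_num) ?_
    -- The source of the constant 6 in `hlarge`: e^6 ≥ 243.
    calc (243 : ℝ) ≤ 2.7 ^ 6 := by norm_num
      _ ≤ Real.exp 1 ^ 6 := by
        gcongr
        linarith [Real.exp_one_gt_d9]
      _ = Real.exp 6 := by rw [← Real.exp_nat_mul]; norm_num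
      _ ≤ _ := Real.exp_le_exp.2 hlarge
  calc P {ω | ∀ z ∈ A, Φ ω (cell s z) = 0} = P {ω | Φ ω (⋃ z ∈ A, cell s z) = 0} := by
        congr 1
        ext ω
        simp [measure_biUnion_cell _ hs]
    _ ≤ _ := hle.measure_count_eq_zero_le hlam hΦ hΨ (isBddBorel_biUnion_cell hs A)
    _ = ENNReal.ofReal (Real.exp (-(lam * s ^ d)) ^ A.card) := by
        rw [volume_real_biUnion_cell hs, ← Real.exp_nat_mul]
        ring_nf
    _ ≤ ENNReal.ofReal (243⁻¹ ^ A.card) := by gcongr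
    _ = _ := by
        rw [ENNReal.ofReal_pow (by positivity), ENNReal.ofReal_inv_of_pos (by positivity)]
        simp

lemma DdcxLE.criticalRadius_le {Ω : Type u} [MeasurableSpace Ω] {P : Measure Ω}
    [IsProbabilityMeasure P] {Φ : Ω → Measure (Space d)} {Ω' : Type v} [MeasurableSpace Ω']
    {Q : Measure Ω'} {Ψ : Ω' → Measure (Space d)} {lam : ℝ} (hlam : 0 ≤ lam) (hd : 2 ≤ d)
    (hΦ : IsPointProcess Φ) (hΨ : IsPoissonProcess Q lam Ψ)
    (hle : DdcxLE P Φ Q Ψ) {s : ℝ} (hs : 0 < s) (hlarge : 6 ≤ lam * s ^ d) :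
    criticalRadius P Φ ≤ ENNReal.ofReal (d * (2 * s)) := by
  refine sInf_le ⟨_, ⟨by positivity, pos_iff_ne_zero.2 fun h0 => ?_⟩, rfl⟩
  have hbad := measure_exists_not_isGood_lt_one (P := P)
    (fun ω => {p | Φ ω (cell s (planeIndex p)) ≠ 0}) fun A => by
      have := hle.measure_empty_le hlam hΦ hΨ hs hlarge (A.image planeIndex)
      rw [Finset.card_image_of_injective _ (planeIndex_injective hd)] at this
      simpa only [Finset.forall_mem_image, Set.mem_ofPred_eq, not_not] using this
  refine absurd hbad (not_lt.2 ?_)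
  -- Only monotonicity and subadditivity are used, so the percolation event need not be measurable.
  calc (1 : ℝ≥0∞) = P Set.univ := measure_univ.symm
    _ ≤ P ({ω | ∃ k, ¬ IsGood {p | Φ ω (cell s (planeIndex p)) ≠ 0} k (0, 0)} ∪
          {ω | Percolates (booleanModel (Φ ω) (d * (2 * s)))}) := by
        refine measure_mono fun ω _ => ?_
        by_cases h : ∃ k, ¬ IsGood {p | Φ ω (cell s (planeIndex p)) ≠ 0} k (0, 0)
        · exact Or.inl h
        · exact Or.inr (percolates_of_isGood hd (hΦ.natValued ω) hs (by simpa using h))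
    _ ≤ _ := (measure_union_le _ _).trans_eq (by rw [h0, add_zero])

/-- In dimension 0 shrinking cells does not reduce their volume, so the lower bound is settled
separately: nothing is unbounded. -/
lemma criticalRadius_eq_top_of_dim_zero {Ω : Type u} [MeasurableSpace Ω] {P : Measure Ω}
    {Φ : Ω → Measure (Space 0)} : criticalRadius P Φ = ∞ := by
  refine sInf_eq_top.2 ?_
  rintro _ ⟨r, ⟨-, hr⟩, rfl⟩
  refine absurd ?_ hr.ne'
  convert measure_empty (μ := P)
  refine Set.eq_empty_iff_forall_notMem.2 fun ω ⟨S, _, _, hS⟩ => hS (Set.toFinite S).isBounded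

end Supercritical

end SubPoisson

/-! ### Choice of constants and conclusion -/

theorem proposition1 :
    ∃ c C : ℕ → ℝ → ℝ, ∀ (d : ℕ) (lam : ℝ), 0 < lam →
      0 < c d lam ∧ c d lam ≤ C d lam ∧
      ∀ (Ω : Type u) [MeasurableSpace Ω] (P : Measure Ω) [IsProbabilityMeasure P]
        (Φ : Ω → Measure (SubPoisson.Space d)), SubPoisson.IsPointProcess Φ →
        (∀ (Ω' : Type v) [MeasurableSpace Ω'] (Q : Measure Ω') [IsProbabilityMeasure Q]
          (Φlam : Ω' → Measure (SubPoisson.Space d)), SubPoisson.IsPoissonProcess Q lam Φlam →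
          (SubPoisson.HasLocallyFiniteMean P Φ → SubPoisson.IdcxLE P Φ Q Φlam →
            ENNReal.ofReal (c d lam) ≤ SubPoisson.criticalRadius P Φ) ∧
          (2 ≤ d → SubPoisson.DdcxLE P Φ Q Φlam →
            SubPoisson.criticalRadius P Φ ≤ ENNReal.ofReal (C d lam)) ∧
          (SubPoisson.IsHomogeneous P lam Φ → SubPoisson.DcxLE P Φ Q Φlam →
            ENNReal.ofReal (c d lam) ≤ SubPoisson.criticalRadius P Φ ∧
            (2 ≤ d → SubPoisson.criticalRadius P Φ ≤ ENNReal.ofReal (C d lam)))) ∧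
        (SubPoisson.IsWeaklySubPoisson P lam Φ →
          ENNReal.ofReal (c d lam) ≤ SubPoisson.criticalRadius P Φ) := by
  -- For d ≥ 1, the comparison with 1 gives s^d ≤ s and t ≤ t^d, so no d-th roots are needed.
  let s : ℕ → ℝ → ℝ := fun d lam => min 1 (1 / (lam * (6 * 3 ^ d)))
  let t : ℝ → ℝ := fun lam => max 1 (6 / lam)
  refine ⟨fun d lam => s d lam / 2, fun d lam => max (s d lam / 2) (d * (2 * t lam)),
    fun d lam hlam => ?_⟩
  have hs : 0 < s d lam := lt_min one_pos (by positivity)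
  have ht : 0 < t lam := lt_max_of_lt_left one_pos
  refine ⟨half_pos hs, le_max_left _ _, fun Ω _ P _ Φ hΦ => ?_⟩
  have lower : (∀ A : Finset (Fin d → ℤ), lam * s d lam ^ d * (6 * 3 ^ d) ≤ 1 →
      P {ω | ∀ z ∈ A, Φ ω (SubPoisson.cell (s d lam) z) ≠ 0} ≤ (2⁻¹ * (3 ^ d)⁻¹) ^ A.card) →
      ENNReal.ofReal (s d lam / 2) ≤ SubPoisson.criticalRadius P Φ := by
    intro h
    rcases Nat.eq_zero_or_pos d with rfl | hd
    · rw [SubPoisson.criticalRadius_eq_top_of_dim_zero]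
      exact le_top
    · refine SubPoisson.le_criticalRadius hs fun A => h A ?_
      have h1 : s d lam ^ d ≤ 1 / (lam * (6 * 3 ^ d)) :=
        (pow_le_of_le_one hs.le (min_le_left _ _) hd.ne').trans (min_le_right _ _)
      rw [le_div_iff₀ (by positivity)] at h1
      linarith
  have upper : 2 ≤ d → 6 ≤ lam * t lam ^ d := by
    intro hd
    have h1 : 6 / lam ≤ t lam ^ d :=
      (le_max_right _ _).trans (le_self_pow₀ (le_max_left _ _) (by omega))
    rwa [div_le_iff₀' hlam] at h1
  refine ⟨fun Ω' _ Q _ Ψ hΨ => ?_, fun h => lower fun A hA =>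
    h.measure_occupied_le hΦ hlam.le hs hA A⟩
  have idcx : SubPoisson.HasLocallyFiniteMean P Φ → SubPoisson.IdcxLE P Φ Q Ψ →
      ENNReal.ofReal (s d lam / 2) ≤ SubPoisson.criticalRadius P Φ := fun hmean hle =>
    lower fun A hA => hle.measure_occupied_le hlam.le hΦ hmean hΨ hs hA A
  have ddcx : 2 ≤ d → SubPoisson.DdcxLE P Φ Q Ψ →
      SubPoisson.criticalRadius P Φ ≤ ENNReal.ofReal (max (s d lam / 2) (d * (2 * t lam))) :=
    fun hd hle => (hle.criticalRadius_le hlam.le hd hΦ hΨ ht (upper hd)).trans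
      (ENNReal.ofReal_le_ofReal (le_max_right _ _))
  -- The dcx order implies the other two, having more test functions; homogeneity supplies the
  -- finite mean.
  refine ⟨idcx, ddcx, fun hhom hle => ⟨idcx (fun B hB => ?_) fun n B hB f hf => hle n B hB f hf.2,
    fun hd => ddcx hd fun n B hB f hf => hle n B hB f hf.2⟩⟩
  rw [hhom B hB]
  exact ENNReal.mul_lt_top ENNReal.ofReal_lt_top hB.2.measure_lt_top
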